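/- Graphs are finite, simple and undirected. An Euler graph is a connected graph that has an Euler circuit. A cycle has type $i\in\{0,1,2,3\}$ if its length is $\equiv i \pmod 4$. Let $\varepsilon_{013}$ be the class of Euler graphs that have cycles of each of the types $0,1,3$ and no cycle of type $2$. A configuration is a graph that is the union of three cycles $A,B,C$ whose types are $0,1,3$ in some order and which intersect in one of the following ways, where "path" means a path with at least one edge: (a) $A\cap B=A\cap C=B\cap C$ is a path; (b) $A\cap B$ is a path and $A\cap C=B\cap C$ is a path that is a proper subpath of it; (c) $A\cap B$ and $B\cap C$ are paths and $A\cap C=\emptyset$; (d) $A\cap B$ and $B\cap C$ are paths and $A\cap C$ has exactly one node, which lies on $B$; (e) $A\cap B$, $B\cap C$, $A\cap C$ are paths and $A\cap B\cap C$ has exactly one node. An extension node of a graph $K$ is a node whose degree in $K$ is two or odd. Adding a path to $K$ at $y$ means adding a path of some length $\ge 1$ from $y$ to another node $z\ne y$ of $K$ whose edges and inner nodes are new. The cases are defined inductively: every configuration is a case, and every graph obtained from a case by adding a path at an extension node is a case. That a case stops is also defined inductively: $K$ stops if it contains a cycle of type $2$, or if it has an extension node $y$ such that every graph obtained from $K$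 by adding a path at $y$ stops. Theorem. Let $G\in\varepsilon_{013}$ have order $p>5$ and no cut node, and suppose that $G$ contains, as a (not necessarily induced) subgraph, a case that stops. Then $G$ has a node of degree two, and $G$ is not regular. Moreover $K_5$ is a regular graph (of degree 4) that belongs to $\varepsilon_{013}$. -/

import Mathlib

namespace EulerMod4

open SimpleGraph

/-- A connected graph that admits an Euler circuit. -/
def IsEulerGraph {V : Type*} (G : SimpleGraph V) : Prop :=
  G.Connected ∧
    ∃ (d : DecidableEq V) (v : V) (p : G.Walk v v), @Walk.IsEulerian V G d v v p

/-- The Euler graphs all of whose cycles have length congruent modulo 4 to a member of `T`,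
and which have at least one cycle of each of these types. -/
def EulerClass (T : Set ℕ) {V : Type*} (G : SimpleGraph V) : Prop :=
  IsEulerGraph G ∧
    (∀ (v : V) (c : G.Walk v v), c.IsCycle → c.length % 4 ∈ T) ∧
    ∀ i ∈ T, ∃ (v : V) (c : G.Walk v v), c.IsCycle ∧ c.length % 4 = i

/-- No node is a cut node. -/
def HasNoCutNode {V : Type*} (G : SimpleGraph V) : Prop :=
  ∀ v : V, (G.induce {v}ᶜ).Connected

section Configurations

variable {W : Type} {K : SimpleGraph W}

/-- The subgraph `A` is a cycle of length congruent to `i` modulo 4. -/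
def IsCycleOfType (A : K.Subgraph) (i : ℕ) : Prop :=
  ∃ (v : W) (c : K.Walk v v), c.IsCycle ∧ c.length % 4 = i ∧ A = c.toSubgraph

/-- The subgraph `P` is a path with at least one edge. -/
def IsProperPath (P : K.Subgraph) : Prop :=
  ∃ (u v : W) (p : K.Walk u v), p.IsPath ∧ 0 < p.length ∧ P = p.toSubgraph

/-- The three subgraphs pairwise intersect in one and the same path. -/
def CommonPath (A B C : K.Subgraph) : Prop :=
  IsProperPath (A ⊓ B) ∧ A ⊓ C = A ⊓ B ∧ B ⊓ C = A ⊓ B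

/-- `A` and `B` intersect in a path, and `C` meets both of them exactly in
a proper subpath of that path. -/
def PartialCommonPath (A B C : K.Subgraph) : Prop :=
  IsProperPath (A ⊓ B) ∧ IsProperPath (A ⊓ C) ∧ B ⊓ C = A ⊓ C ∧ A ⊓ C < A ⊓ B

/-- `B` intersects the disjoint subgraphs `A` and `C` in a path each. -/
def DisjointChain (A B C : K.Subgraph) : Prop :=
  IsProperPath (A ⊓ B) ∧ IsProperPath (B ⊓ C) ∧ A ⊓ C = ⊥

/-- `B` intersects `A` and `C` in a path each, and `A` and `C` share exactly one node,
which lies on `B`. -/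
def TouchingChain (A B C : K.Subgraph) : Prop :=
  IsProperPath (A ⊓ B) ∧ IsProperPath (B ⊓ C) ∧
    ∃ x : W, x ∈ B.verts ∧ (A ⊓ C).verts = {x}

/-- Any two of the subgraphs intersect in a path, and exactly one node is common to all three. -/
def PairwisePaths (A B C : K.Subgraph) : Prop :=
  IsProperPath (A ⊓ B) ∧ IsProperPath (B ⊓ C) ∧ IsProperPath (A ⊓ C) ∧
    ∃ x : W, (A ⊓ B ⊓ C).verts = {x}

end Configurations

/-- `K` is the union of three intersecting cycles, one of each of the types 0, 1, 3
(in some order), intersecting in one of the five patterns. -/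
def IsConfiguration {W : Type} (K : SimpleGraph W) : Prop :=
  ∃ (i j k : ℕ) (A B C : K.Subgraph),
    [i, j, k].Perm [0, 1, 3] ∧
    IsCycleOfType A i ∧ IsCycleOfType B j ∧ IsCycleOfType C k ∧
    A ⊔ B ⊔ C = ⊤ ∧
    (CommonPath A B C ∨ PartialCommonPath A B C ∨ DisjointChain A B C ∨
      TouchingChain A B C ∨ PairwisePaths A B C)

/-- A node at which a new path may be required to start: either it has degree two in `K` (so that
it has degree two in the Euler graph, or has further edges), or it has odd degree in `K` (so that
it has further edges in any Euler graph containing `K`). -/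
def IsExtensionNode {W : Type} (K : SimpleGraph W) (y : W) : Prop :=
  (K.neighborSet y).ncard = 2 ∨ Odd (K.neighborSet y).ncard

/-- `K'` arises from `K` (embedded through `f`) by adding a path of positive length that joins `y`
to another node `z` of `K` and has no edge and no inner node in common with `K`. -/
def IsPathAddition {W W' : Type} (K : SimpleGraph W) (y : W) (K' : SimpleGraph W')
    (f : W ↪ W') : Prop :=
  ∃ (z : W) (p : K'.Walk (f y) (f z)), z ≠ y ∧ p.IsPath ∧
    (∀ w : W, f w ∈ p.support → w = y ∨ w = z) ∧
    (∀ e ∈ p.edges, e ∉ (K.map f).edgeSet) ∧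
    (∀ e : Sym2 W', e ∈ K'.edgeSet ↔ e ∈ (K.map f).edgeSet ∨ e ∈ p.edges) ∧
    ∀ w' : W', w' ∈ Set.range f ∨ w' ∈ p.support

/-- The cases of the analysis: the configurations at the first level, and at every further level
the graphs arising from a case by adding a path at an extension node. -/
inductive IsCase : {W : Type} → SimpleGraph W → Prop
  | initial {W : Type} (K : SimpleGraph W) : IsConfiguration K → IsCase K
  | next {W W' : Type} (K : SimpleGraph W) (y : W) (K' : SimpleGraph W') (f : W ↪ W') :
      IsCase K → IsExtensionNode K y → IsPathAddition K y K' f → IsCase K'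

/-- A case stops if it contains a cycle of the fourth type (length congruent to 2 modulo 4), or if
it has an extension node such that all subcases, obtained by adding a path of any length from this
node to any other node, stop. -/
inductive Stops : {W : Type} → SimpleGraph W → Prop
  | fourthType {W : Type} (K : SimpleGraph W) (v : W) (c : K.Walk v v) :
      c.IsCycle → c.length % 4 = 2 → Stops K
  | allSubcases {W : Type} (K : SimpleGraph W) (y : W) :
      IsExtensionNode K y →
      (∀ (W' : Type) (K' : SimpleGraph W') (f : W ↪ W'), IsPathAddition K y K' f → Stops K') →
      Stops K

end EulerMod4

/-!
The existence of a node of degree two is an induction along `Stops`. Let `K` be a graph that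
stops, embedded in a graph `G` with even degrees, no cut node and no cycle of length 2 modulo 4.
Then `K` itself contains no such cycle, so it has an extension node `y` all of whose path
additions stop. If `y` has degree two in `G`, this is the node sought. Otherwise `y` has a
`G`-edge outside `K`, because its degree in `K` is two or odd whereas its degree in `G` is even
and not two. Since `y` is not a cut node, this edge can be prolonged in `G - y` until it meets `K`
again, and the path obtained is a path addition at `y` that is still contained in `G`
(`exists_isPathAddition`), to which the induction hypothesis applies.

Non-regularity follows: a regular `G` would be 2-regular, and in a connected 2-regular graph every
cycle is spanning (`length_eq_card_of_two_regular`), so `G` could not have cycles of two types.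
For `K₅` an Euler circuit is written down; its cycles have length 3, 4 or 5, and all three occur.
-/

namespace EulerMod4

open SimpleGraph

/-- Truncating a walk at its first vertex in `S`. -/
lemma exists_walk_first_mem {V : Type*} {G : SimpleGraph V} (S : Set V) {a b : V}
    (p : G.Walk a b) (hb : b ∈ S) :
    ∃ z ∈ S, ∃ q : G.Walk a z, q.support ⊆ p.support ∧ ∀ w ∈ q.support, w ∈ S → w = z := by
  induction p with
  | nil => exact ⟨_, hb, Walk.nil, by simp, by simp⟩
  | @cons u v w h p ih =>
    by_cases hu : u ∈ S
    · exact ⟨u, hu, Walk.nil, by simp, by simp⟩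
    · obtain ⟨z, hz, q, hq, hqS⟩ := ih hb
      refine ⟨z, hz, Walk.cons h q, ?_, ?_⟩
      · simp only [Walk.support_cons]
        exact List.cons_subset_cons _ hq
      · intro x hx hxS
        rw [Walk.support_cons, List.mem_cons] at hx
        rcases hx with rfl | hx
        · exact absurd hxS hu
        · exact hqS x hx hxS

lemma exists_walk_comap {V W : Type*} {G : SimpleGraph V} (e : W ↪ V) {u v : V}
    (p : G.Walk u v) (hp : ∀ x ∈ p.support, x ∈ Set.range e) (u' v' : W) (hu : e u' = u)
    (hv : e v' = v) :
    ∃ q : (G.comap e).Walk u' v',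
      q.support.map e = p.support ∧ q.edges.map (Sym2.map e) = p.edges := by
  induction p generalizing u' with
  | nil =>
    obtain rfl := e.injective (hu.trans hv.symm)
    exact ⟨Walk.nil, by simp [hu], by simp⟩
  | @cons a b c h p ih =>
    obtain ⟨b', rfl⟩ := hp b (by simp)
    obtain ⟨q, hq, hq'⟩ := ih (fun x hx => hp x (by simp [hx])) b' rfl hv
    subst hu
    exact ⟨Walk.cons (by simpa using h) q, by simp [hq], by simp [hq']⟩

/-- In a graph without cut nodes, an edge at a node `y` of a subgraph `K` that does not belong
to `K` extends to a path from `y` to another node of `K` that is otherwise disjoint from `K`. -/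
lemma exists_path_back {V W : Type*} {G : SimpleGraph V} (hG : HasNoCutNode G)
    {K : SimpleGraph W} (φ : K.Copy G) {y x : W} (hx : x ≠ y) {a : V}
    (ha : G.Adj (φ y) a) (hna : ∀ x, K.Adj y x → φ x ≠ a) :
    ∃ (z : W) (p : G.Walk (φ y) (φ z)), z ≠ y ∧ p.IsPath ∧
      (∀ w, φ w ∈ p.support → w = y ∨ w = z) ∧
      ∀ e ∈ p.edges, e ∉ (K.map φ.toEmbedding).edgeSet := by
  classical
  have hφ : Function.Injective φ := φ.injective
  obtain ⟨p₀⟩ := (hG (φ y)).preconnected ⟨a, ha.ne'⟩ ⟨φ x, fun h => hx (hφ h)⟩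
  obtain ⟨⟨b, hb⟩, ⟨z, hz⟩, q₀, -, hq₀⟩ :=
    exists_walk_first_mem {v : ({φ y}ᶜ : Set V) | (v : V) ∈ Set.range φ} p₀ ⟨x, rfl⟩
  obtain rfl : φ z = b := hz
  let q₁ := q₀.map (Embedding.induce ({φ y}ᶜ : Set V)).toHom
  have hq₁ : ∀ v ∈ q₁.support, v ≠ φ y ∧ (v ∈ Set.range φ → v = φ z) := by
    intro v hv
    rw [Walk.support_map, List.mem_map] at hv
    obtain ⟨v, hv, rfl⟩ := hv
    exact ⟨v.2, fun h => congrArg Subtype.val (hq₀ v hv h)⟩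
  have key : ∃ q : G.Walk a (φ z), q.IsPath ∧
      ∀ v ∈ q.support, v ≠ φ y ∧ (v ∈ Set.range φ → v = φ z) :=
    ⟨q₁.bypass, q₁.bypass_isPath, fun v hv => hq₁ v (q₁.support_bypass_subset_support hv)⟩
  obtain ⟨q, hq, hqs⟩ := key
  refine ⟨z, Walk.cons ha q, fun h => hb (by simp [h]), ?_, ?_, ?_⟩
  · exact (Walk.cons_isPath_iff ha q).2 ⟨hq, fun h => (hqs _ h).1 rfl⟩
  · intro w hw
    rw [Walk.support_cons, List.mem_cons] at hw
    rcases hw with hw | hw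
    · exact Or.inl (hφ hw)
    · exact Or.inr (hφ ((hqs _ hw).2 ⟨w, rfl⟩))
  · intro e he
    induction e with | _ s t
    intro hst
    obtain ⟨-, u, v, huv, hu, hv⟩ := hst
    change φ u = s at hu
    change φ v = t at hv
    subst hu hv
    rw [Walk.edges_cons, List.mem_cons] at he
    rcases he with he | he
    · rcases Sym2.eq_iff.1 he with ⟨h1, h2⟩ | ⟨h1, h2⟩
      · exact hna v (hφ h1 ▸ huv) h2
      · exact hna u (hφ h2 ▸ huv.symm) h1
    · -- both ends lie on `q` and in `K`, hence both are its last vertex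
      have h1 := (hqs _ (q.fst_mem_support_of_mem_edges he)).2 ⟨u, rfl⟩
      have h2 := (hqs _ (q.snd_mem_support_of_mem_edges he)).2 ⟨v, rfl⟩
      exact huv.ne (hφ (h1.trans h2.symm))

/-- An edge of `G` at a node `y` of `K` that does not belong to `K` gives rise to a path addition
of `K` at `y` that is again contained in `G`. -/
lemma exists_isPathAddition {V : Type*} [Finite V] {G : SimpleGraph V} (hG : HasNoCutNode G)
    {W : Type} {K : SimpleGraph W} (φ : K.Copy G) {y x : W} (hx : x ≠ y) {a : V}
    (ha : G.Adj (φ y) a) (hna : ∀ x, K.Adj y x → φ x ≠ a) :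
    ∃ (W' : Type) (K' : SimpleGraph W') (f : W ↪ W'),
      IsPathAddition K y K' f ∧ K'.IsContained G := by
  classical
  obtain ⟨z, p, hzy, hp, hpK, hpe⟩ := exists_path_back hG φ hx ha hna
  let H : SimpleGraph V := K.map φ.toEmbedding ⊔ fromEdgeSet {e | e ∈ p.edges}
  have hHe : ∀ e, e ∈ H.edgeSet ↔ e ∈ (K.map φ.toEmbedding).edgeSet ∨ e ∈ p.edges := by
    intro e
    simp only [H, edgeSet_sup, edgeSet_fromEdgeSet, Set.mem_union, Set.mem_sdiff, Set.mem_ofPred_eq]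
    refine or_congr Iff.rfl ⟨fun h => h.1, fun h => ⟨h, ?_⟩⟩
    exact G.not_isDiag_of_mem_edgeSet (p.edges_subset_edgeSet h)
  have hHG : H ≤ G := by
    rw [← edgeSet_subset_edgeSet]
    intro e he
    rcases (hHe e).1 he with h | h
    · induction e with | _ s t
      obtain ⟨-, u, v, huv, rfl, rfl⟩ := h
      exact φ.toHom.map_adj huv
    · exact p.edges_subset_edgeSet h
  let S : Set V := Set.range φ ∪ {v | v ∈ p.support}
  -- `IsPathAddition` asks for a vertex type in `Type`, so the vertices in `S` are enumerated
  obtain ⟨n, ⟨ε⟩⟩ := Finite.exists_equiv_fin S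
  let e : Fin n ↪ V := ε.symm.toEmbedding.trans (Function.Embedding.subtype _)
  have he : ∀ v ∈ S, ∃ i, e i = v := fun v hv => ⟨ε ⟨v, hv⟩, by simp [e]⟩
  let f : W ↪ Fin n :=
    ⟨fun w => ε ⟨φ w, Or.inl ⟨w, rfl⟩⟩, fun u v huv =>
      φ.injective (congrArg Subtype.val (ε.injective huv))⟩
  have hef : ∀ w, e (f w) = φ w := fun w =>
    congrArg Subtype.val (ε.symm_apply_apply ⟨φ w, Or.inl ⟨w, rfl⟩⟩)
  obtain ⟨q, hqs, hqe⟩ := exists_walk_comap e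
    (p.transfer H (fun d hd => (hHe d).2 (Or.inr hd)))
    (fun v hv => he v (Or.inr (by simpa using hv))) (f y) (f z) (hef y) (hef z)
  rw [Walk.support_transfer] at hqs
  rw [Walk.edges_transfer] at hqe
  have hsup : ∀ i, i ∈ q.support ↔ e i ∈ p.support := fun i => by
    rw [← hqs, List.mem_map_of_injective e.injective]
  have hedg : ∀ d, d ∈ q.edges ↔ Sym2.map e d ∈ p.edges := fun d => by
    rw [← hqe, List.mem_map_of_injective (Sym2.map.injective e.injective)]
  have hmap : ∀ d, d ∈ (K.map f).edgeSet ↔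
      Sym2.map e d ∈ (K.map φ.toEmbedding).edgeSet := by
    intro d
    induction d with | _ s t
    simp only [Sym2.map_mk, mem_edgeSet, map_adj]
    constructor
    · rintro ⟨u, v, h, rfl, rfl⟩
      exact ⟨u, v, h, (hef u).symm, (hef v).symm⟩
    · rintro ⟨u, v, h, hu, hv⟩
      exact ⟨u, v, h, e.injective ((hef u).trans hu), e.injective ((hef v).trans hv)⟩
  refine ⟨Fin n, H.comap e, f, ⟨z, q, hzy, ?_, ?_, ?_, ?_, ?_⟩, ?_⟩
  · rw [Walk.isPath_def]
    exact List.Nodup.of_map e (hqs ▸ hp.support_nodup)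
  · intro w hw
    exact hpK w (hef w ▸ (hsup _).1 hw)
  · intro d hd
    rw [hmap]
    exact hpe _ ((hedg d).1 hd)
  · intro d
    rw [hmap, hedg, ← hHe]
    induction d with | _ s t
    rfl
  · intro i
    rcases (ε.symm i).2 with ⟨w, hw⟩ | h
    · exact Or.inl ⟨w, e.injective ((hef w).trans hw)⟩
    · exact Or.inr ((hsup i).2 h)
  · exact ⟨⟨⟨e, fun h => hHG h⟩, e.injective⟩⟩

/-- At an extension node of a subgraph, a graph with even degrees has degree two or an edge outside
the subgraph. -/
lemma IsExtensionNode.degree_eq_two_or_exists_adj {V : Type*} {G : SimpleGraph V}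
    [G.LocallyFinite] (hE : ∀ v, Even (G.degree v)) {W : Type} {K : SimpleGraph W} {y : W}
    (hy : IsExtensionNode K y) (φ : K.Copy G) :
    G.degree (φ y) = 2 ∨ ∃ a, G.Adj (φ y) a ∧ ∀ x, K.Adj y x → φ x ≠ a := by
  by_contra! h
  obtain ⟨h2, h⟩ := h
  have himg : φ '' K.neighborSet y = G.neighborSet (φ y) := by
    ext a
    constructor
    · rintro ⟨x, hx, rfl⟩
      exact φ.toHom.map_adj hx
    · intro ha
      obtain ⟨x, hx, hxa⟩ := h a ha
      exact ⟨x, hx, hxa⟩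
  have hdeg : (K.neighborSet y).ncard = G.degree (φ y) := by
    rw [← Set.ncard_image_of_injective (f := φ) _ φ.injective, himg, Set.ncard_eq_toFinset_card',
      ← card_neighborSet_eq_degree, Set.toFinset_card]
  rcases hy with hy | hy
  · exact h2 (hdeg ▸ hy)
  · exact Nat.not_even_iff_odd.2 (hdeg ▸ hy) (hE _)

lemma IsExtensionNode.exists_ne {W : Type} {K : SimpleGraph W} {y : W}
    (hy : IsExtensionNode K y) : ∃ x, x ≠ y := by
  have h : (K.neighborSet y).ncard ≠ 0 := by
    rcases hy with hy | hy
    · omega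
    · exact hy.pos.ne'
  obtain ⟨x, hx⟩ := Set.nonempty_of_ncard_ne_zero h
  exact ⟨x, (K.ne_of_adj hx).symm⟩

lemma Stops.exists_degree_eq_two {V : Type*} [Finite V] {G : SimpleGraph V} [G.LocallyFinite]
    (hE : ∀ v, Even (G.degree v)) (hG : HasNoCutNode G)
    (hc : ∀ (v : V) (c : G.Walk v v), c.IsCycle → c.length % 4 ≠ 2)
    {W : Type} {K : SimpleGraph W} (hK : Stops K) (hKG : K.IsContained G) :
    ∃ v, G.degree v = 2 := by
  induction hK with
  | fourthType K v c hcyc hlen =>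
    obtain ⟨φ⟩ := hKG
    exact absurd (by simpa using hlen) (hc _ (c.map φ.toHom) (hcyc.map φ.injective))
  | allSubcases K y hy _ ih =>
    obtain ⟨φ⟩ := hKG
    obtain ⟨x, hx⟩ := hy.exists_ne
    rcases hy.degree_eq_two_or_exists_adj hE φ with h | ⟨a, ha, hna⟩
    · exact ⟨_, h⟩
    · obtain ⟨W', K', f, hadd, hK'G⟩ := exists_isPathAddition hG φ hx ha hna
      exact ih W' K' f hadd hK'G

/-- Every cycle of a connected 2-regular graph is spanning. -/
lemma length_eq_card_of_two_regular {V : Type*} [Fintype V] {G : SimpleGraph V}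
    [G.LocallyFinite] (hconn : G.Connected) (hreg : G.IsRegularOfDegree 2) {v : V}
    {c : G.Walk v v} (hc : c.IsCycle) : c.length = Fintype.card V := by
  classical
  -- the cycle uses both edges at each of its vertices, so its support is closed under adjacency
  have hstep : ∀ a b, a ∈ c.support → G.Adj a b → b ∈ c.support := by
    intro a b ha hab
    have h : c.toSubgraph.neighborSet a = G.neighborSet a := by
      refine Set.eq_of_subset_of_ncard_le (c.toSubgraph.neighborSet_subset a) ?_
      rw [hc.ncard_neighborSet_toSubgraph_eq_two ha, Set.ncard_eq_toFinset_card',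
        Set.toFinset_card, card_neighborSet_eq_degree, hreg a]
    have hb : b ∈ c.toSubgraph.neighborSet a := h ▸ hab
    exact c.mem_verts_toSubgraph.1 (c.toSubgraph.edge_vert hb.symm)
  have hall : ∀ a, a ∈ c.support := by
    intro a
    obtain ⟨p⟩ := hconn.preconnected v a
    have aux : ∀ (s t : V), G.Walk s t → s ∈ c.support → t ∈ c.support := by
      intro s t p
      induction p with
      | nil => exact id
      | cons h _ ih => exact fun hs => ih (hstep _ _ hs h)
    exact aux v a p c.start_mem_support
  have htail : ∀ a, a ∈ c.support.tail := by
    intro a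
    rcases c.mem_support_iff.1 (hall a) with rfl | h
    · exact c.end_mem_tail_support hc.not_nil
    · exact h
  have hfin : c.support.tail.toFinset = Finset.univ := by
    ext a; simp [htail a]
  rw [← Finset.card_univ, ← hfin, List.toFinset_card_of_nodup hc.support_nodup]
  simp

lemma eulerClass_completeGraph_five :
    EulerClass {0, 1, 3} (SimpleGraph.completeGraph (Fin 5)) := by
  have adj : ∀ {a b : Fin 5}, a ≠ b → (SimpleGraph.completeGraph (Fin 5)).Adj a b := fun h => h
  refine ⟨⟨connected_top, inferInstance, 0, ?_⟩, ?_, ?_⟩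
  · let p : (SimpleGraph.completeGraph (Fin 5)).Walk 0 0 :=
      .cons (adj (b := 1) (by decide)) <| .cons (adj (b := 2) (by decide)) <|
      .cons (adj (b := 3) (by decide)) <| .cons (adj (b := 4) (by decide)) <|
      .cons (adj (b := 0) (by decide)) <| .cons (adj (b := 2) (by decide)) <|
      .cons (adj (b := 4) (by decide)) <| .cons (adj (b := 1) (by decide)) <|
      .cons (adj (b := 3) (by decide)) <| .cons (adj (by decide)) .nil
    have hp : ∀ a b : Fin 5, a ≠ b → p.edges.count s(a, b) = 1 := by
      simp only [p, Walk.edges_cons, Walk.edges_nil]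
      decide
    refine ⟨p, fun e he => ?_⟩
    induction e with | _ a b
    exact hp a b he
  · intro v c hc
    have h3 := hc.three_le_length
    have h5 : c.length ≤ 5 := by
      have := hc.support_nodup.length_le_card
      simpa using this
    interval_cases c.length <;> simp
  · rintro i (rfl | rfl | rfl)
    · refine ⟨0, .cons (adj (b := 1) (by decide)) (.cons (adj (b := 2) (by decide))
        (.cons (adj (b := 3) (by decide)) (.cons (adj (by decide)) .nil))), ?_, by simp⟩
      simp [Walk.isCycle_def, Walk.isTrail_def]
    · refine ⟨0, .cons (adj (b := 1) (by decide)) (.cons (adj (b := 2) (by decide))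
        (.cons (adj (b := 3) (by decide)) (.cons (adj (b := 4) (by decide))
        (.cons (adj (by decide)) .nil)))), ?_, by simp⟩
      simp [Walk.isCycle_def, Walk.isTrail_def]
    · refine ⟨0, .cons (adj (b := 1) (by decide)) (.cons (adj (b := 2) (by decide))
        (.cons (adj (by decide)) .nil)), ?_, by simp⟩
      simp [Walk.isCycle_def, Walk.isTrail_def]

end EulerMod4

theorem theorem8 :
    (∀ (V : Type*) [Fintype V] (G : SimpleGraph V) [DecidableRel G.Adj],
      EulerMod4.EulerClass {0, 1, 3} G →
      EulerMod4.HasNoCutNode G →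
      5 < Fintype.card V →
      ∀ (W : Type) (K : SimpleGraph W),
        EulerMod4.IsCase K → EulerMod4.Stops K → SimpleGraph.IsContained K G →
          (∃ v : V, G.degree v = 2) ∧ ¬ ∃ d : ℕ, G.IsRegularOfDegree d) ∧
    (EulerMod4.EulerClass {0, 1, 3} (SimpleGraph.completeGraph (Fin 5)) ∧
      (SimpleGraph.completeGraph (Fin 5)).IsRegularOfDegree 4) := by
  refine ⟨?_, EulerMod4.eulerClass_completeGraph_five, fun v => by simp⟩
  intro V _ G _ hG hcut _ W K _ hK hKG
  obtain ⟨⟨hconn, _, u, p, hp⟩, htype, hex⟩ := hG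
  have heven : ∀ v, Even (G.degree v) := fun v => hp.even_degree_iff.2 fun h => absurd rfl h
  have hdeg : ∃ v : V, G.degree v = 2 := by
    refine hK.exists_degree_eq_two heven hcut (fun v c hc h2 => ?_) hKG
    simpa [h2] using htype v c hc
  refine ⟨hdeg, ?_⟩
  rintro ⟨d, hd⟩
  obtain ⟨v, hv⟩ := hdeg
  obtain rfl : d = 2 := (hd v).symm.trans hv
  obtain ⟨_, c₀, hc₀, h₀⟩ := hex 0 (by simp)
  obtain ⟨_, c₁, hc₁, h₁⟩ := hex 1 (by simp)
  rw [EulerMod4.length_eq_card_of_two_regular hconn hd hc₀] at h₀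
  rw [EulerMod4.length_eq_card_of_two_regular hconn hd hc₁] at h₁
  omega
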